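/- Let $d\ge 1$, let $A_1,A_2$ be quantum systems with Hilbert space $\mathbb{C}^d$, and let $F$ be the swap operator on $\mathbb{C}^d\otimes\mathbb{C}^d$, $F(|\psi\rangle\otimes|\phi\rangle)=|\phi\rangle\otimes|\psi\rangle$. Let $|\psi\rangle,|\phi\rangle$ be independent Haar-distributed unit vectors of $\mathbb{C}^d$ (i.e. each distributed according to the unitarily invariant probability measure on the unit sphere), and write $\psi=|\psi\rangle\langle\psi|$, $\phi=|\phi\rangle\langle\phi|$. For a linear map $\Lambda$ on operators on $A_1A_2$, the average fidelity with which it simulates $F$ on this ensemble is $$f(\Lambda)=\int\!\mathrm{d}\psi\int\!\mathrm{d}\phi\ \operatorname{Tr}\big[\Lambda(\psi\otimes\phi)\,(\phi\otimes\psi)\big].$$ Let $\mathrm{LOCC}$ be the set of channels $A_1A_2\to A_1A_2$ implemented by finite protocols of local operations (instruments with finitely many outcomes, performed by one party on its own system with arbitrary finite-dimensional local ancillas) and classical communication between the two parties. Then: 1. Every $\Lambda\in\mathrm{LOCC}$, and more generally every limit of such channels, satisfies $f(\Lambda)\le\left(\frac{2}{d+1}\right)^2$. 2. The bound is attained by measuring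 and preparing each state independently: the channel in which the two parties each measure with the uniform POVM $(d\,\psi\,\mathrm{d}\psi)_\psi$, communicate the outcomes, and each prepare the pure state given by the other party's outcome, i.e. $$\Lambda(X)=d^2\int\!\mathrm{d}\psi\int\!\mathrm{d}\phi\ \operatorname{Tr}\big[X\,(\psi\otimes\phi)\big]\ \phi\otimes\psi ,$$ belongs to $\mathrm{LOCC}$ and satisfies $f(\Lambda)=\left(\frac{2}{d+1}\right)^2$. 3. Consequently the LOCC simulation fidelity of the swap on this ensemble is $$F_{c\ell}:=\sup_{\Lambda\in\mathrm{LOCC}}f(\Lambda)=\left(\frac{2}{d+1}\right)^2 .$$ -/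

import Mathlib

open MeasureTheory
open scoped ComplexOrder

/-- The operator `E ⊗ id` on matrices over a bipartite index set: `E` acts on the first factor. -/
def onFst {a a' b : Type*} (E : Matrix a a ℂ →ₗ[ℂ] Matrix a' a' ℂ) :
    Matrix (a × b) (a × b) ℂ →ₗ[ℂ] Matrix (a' × b) (a' × b) ℂ where
  toFun X := Matrix.of fun p q => E (Matrix.of fun i j => X (i, p.2) (j, q.2)) p.1 q.1
  map_add' X Y := by
    ext p q
    exact congrFun (congrFun (map_add E (Matrix.of fun i j => X (i, p.2) (j, q.2))
      (Matrix.of fun i j => Y (i, p.2) (j, q.2))) p.1) q.1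
  map_smul' c X := by
    ext p q
    exact congrFun (congrFun (map_smul E c
      (Matrix.of fun i j => X (i, p.2) (j, q.2))) p.1) q.1

/-- The operator `id ⊗ E` on matrices over a bipartite index set: `E` acts on the second factor. -/
def onSnd {a b b' : Type*} (E : Matrix b b ℂ →ₗ[ℂ] Matrix b' b' ℂ) :
    Matrix (a × b) (a × b) ℂ →ₗ[ℂ] Matrix (a × b') (a × b') ℂ where
  toFun X := Matrix.of fun p q => E (Matrix.of fun i j => X (p.1, i) (q.1, j)) p.2 q.2
  map_add' X Y := by
    ext p q
    exact congrFun (congrFun (map_add E (Matrix.of fun i j => X (p.1, i) (q.1, j))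
      (Matrix.of fun i j => Y (p.1, i) (q.1, j))) p.2) q.2
  map_smul' c X := by
    ext p q
    exact congrFun (congrFun (map_smul E c
      (Matrix.of fun i j => X (p.1, i) (q.1, j))) p.2) q.2

/-- Complete positivity: `E ⊗ id` preserves positive semidefiniteness for every finite-dimensional
ancilla. -/
def IsCompletelyPositive {m m' : ℕ}
    (E : Matrix (Fin m) (Fin m) ℂ →ₗ[ℂ] Matrix (Fin m') (Fin m') ℂ) : Prop :=
  ∀ (k : ℕ) (X : Matrix (Fin m × Fin k) (Fin m × Fin k) ℂ),
    X.PosSemidef → (onFst E X).PosSemidef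

/-- A quantum instrument with finitely many outcomes `i`: completely positive maps `E i`
(whose output dimension `r i` may depend on the outcome) with trace preserving sum. -/
structure IsInstrument {m k : ℕ} {r : Fin k → ℕ}
    (E : ∀ i, Matrix (Fin m) (Fin m) ℂ →ₗ[ℂ] Matrix (Fin (r i)) (Fin (r i)) ℂ) : Prop where
  completelyPositive : ∀ i, IsCompletelyPositive (E i)
  tracePreserving : ∀ X : Matrix (Fin m) (Fin m) ℂ, ∑ i, (E i X).trace = X.trace

/-- Channels between bipartite systems implemented by a finite protocol of local operations and
classical communication, with output dimensions `m'`, `n'`. A protocol either ends, or one of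
the two parties performs an instrument on their own system (possibly adjoining, processing or
discarding ancillas, as dimensions are arbitrary), announces the outcome `i`, and the protocol
continues with an LOCC protocol `Λ i` that may depend on `i`. -/
inductive IsLOCC {m' n' : ℕ} : {m n : ℕ} →
    (Matrix (Fin m × Fin n) (Fin m × Fin n) ℂ →ₗ[ℂ]
      Matrix (Fin m' × Fin n') (Fin m' × Fin n') ℂ) → Prop
  | idle : IsLOCC LinearMap.id
  | first {m n k : ℕ} {r : Fin k → ℕ}
      (E : ∀ i, Matrix (Fin m) (Fin m) ℂ →ₗ[ℂ] Matrix (Fin (r i)) (Fin (r i)) ℂ)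
      (hE : IsInstrument E)
      (Λ : ∀ i, Matrix (Fin (r i) × Fin n) (Fin (r i) × Fin n) ℂ →ₗ[ℂ]
        Matrix (Fin m' × Fin n') (Fin m' × Fin n') ℂ)
      (hΛ : ∀ i, IsLOCC (Λ i)) :
      IsLOCC (∑ i, (Λ i) ∘ₗ (onFst (E i) :
        Matrix (Fin m × Fin n) (Fin m × Fin n) ℂ →ₗ[ℂ] _))
  | second {m n k : ℕ} {r : Fin k → ℕ}
      (E : ∀ i, Matrix (Fin n) (Fin n) ℂ →ₗ[ℂ] Matrix (Fin (r i)) (Fin (r i)) ℂ)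
      (hE : IsInstrument E)
      (Λ : ∀ i, Matrix (Fin m × Fin (r i)) (Fin m × Fin (r i)) ℂ →ₗ[ℂ]
        Matrix (Fin m' × Fin n') (Fin m' × Fin n') ℂ)
      (hΛ : ∀ i, IsLOCC (Λ i)) :
      IsLOCC (∑ i, (Λ i) ∘ₗ (onSnd (E i) :
        Matrix (Fin m × Fin n) (Fin m × Fin n) ℂ →ₗ[ℂ] _))

/-- Limits of LOCC channels. On these finite-dimensional spaces, pointwise and norm convergence of
linear maps agree. -/
def IsLimitOfLOCC {m n m' n' : ℕ}
    (Λ : Matrix (Fin m × Fin n) (Fin m × Fin n) ℂ →ₗ[ℂ]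
      Matrix (Fin m' × Fin n') (Fin m' × Fin n') ℂ) : Prop :=
  ∃ Λs : ℕ → (Matrix (Fin m × Fin n) (Fin m × Fin n) ℂ →ₗ[ℂ]
      Matrix (Fin m' × Fin n') (Fin m' × Fin n') ℂ),
    (∀ t, IsLOCC (Λs t)) ∧
    ∀ X, Filter.Tendsto (fun t => Λs t X) Filter.atTop (nhds (Λ X))

/-- The rank-one operator `|ψ⟩⟨ψ|`. -/
def pureState {ι : Type*} (ψ : EuclideanSpace ℂ ι) : Matrix ι ι ℂ :=
  Matrix.vecMulVec ψ.ofLp (star ψ.ofLp)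

section Fidelity

variable {Ω : Type*} [MeasurableSpace Ω] {m n m' n' : ℕ}

/-- The average fidelity `∫ Tr[Λ(ψ_α) U ψ_α U†] dμ(α)` with which `Λ` simulates the isometry `U` on
the ensemble of pure states `ψ_α`, with `α` distributed according to `μ`. -/
noncomputable def averageFidelity (μ : Measure Ω)
    (ψ : Ω → EuclideanSpace ℂ (Fin m × Fin n))
    (U : EuclideanSpace ℂ (Fin m × Fin n) →ₗᵢ[ℂ] EuclideanSpace ℂ (Fin m' × Fin n'))
    (Λ : Matrix (Fin m × Fin n) (Fin m × Fin n) ℂ →ₗ[ℂ]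
      Matrix (Fin m' × Fin n') (Fin m' × Fin n') ℂ) : ℝ :=
  ∫ α, (Matrix.trace (Λ (pureState (ψ α)) * pureState (U (ψ α)))).re ∂μ

/-- The LOCC simulation fidelity of `U` on the ensemble `(μ, ψ)`. -/
noncomputable def simulationFidelity (μ : Measure Ω)
    (ψ : Ω → EuclideanSpace ℂ (Fin m × Fin n))
    (U : EuclideanSpace ℂ (Fin m × Fin n) →ₗᵢ[ℂ] EuclideanSpace ℂ (Fin m' × Fin n')) : ℝ :=
  sSup (averageFidelity μ ψ U '' {Λ | IsLOCC Λ})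

end Fidelity

/-- The unit sphere of `ℂ^d`, i.e. normalised state vectors of a qudit. -/
abbrev StateVector (d : ℕ) : Type := Metric.sphere (0 : EuclideanSpace ℂ (Fin d)) 1

/-- The Haar (unitarily invariant) probability measure on qudit state vectors: the normalised
surface measure on the unit sphere of `ℂ^d`. -/
noncomputable def haarState (d : ℕ) : Measure (StateVector d) :=
  ((volume : Measure (EuclideanSpace ℂ (Fin d))).toSphere Set.univ)⁻¹ •
    (volume : Measure (EuclideanSpace ℂ (Fin d))).toSphere

/-- The product vector `|ψ⟩ ⊗ |φ⟩`. -/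
def productVector {a b : Type*} (ψ : EuclideanSpace ℂ a) (φ : EuclideanSpace ℂ b) :
    EuclideanSpace ℂ (a × b) :=
  WithLp.toLp 2 fun p => ψ p.1 * φ p.2

/-- The swap operator on two qudits. -/
noncomputable def swapOperator (d : ℕ) :
    EuclideanSpace ℂ (Fin d × Fin d) →ₗᵢ[ℂ] EuclideanSpace ℂ (Fin d × Fin d) :=
  (LinearIsometryEquiv.piLpCongrLeft 2 ℂ ℂ (Equiv.prodComm (Fin d) (Fin d))).toLinearIsometry

theorem swapOperator_productVector {d : ℕ} (ψ φ : EuclideanSpace ℂ (Fin d)) :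
    swapOperator d (productVector ψ φ) = productVector φ ψ := by
  ext p
  exact mul_comm _ _

/-!
Every LOCC channel is separable: it is a sum of maps `X ↦ (A ⊗ B) X (A ⊗ B)†`. Such a term
contributes `∫∫ |⟨φ, A ψ⟩|² |⟨ψ, B φ⟩|²` to the average fidelity with the swap. A unitarily
invariant probability measure satisfies
`∫ |⟨ψ, u⟩|² |⟨ψ, v⟩|² = (‖u‖² ‖v‖² + |⟨u, v⟩|²) / (d (d + 1)) ≤ 2 ‖u‖² ‖v‖² / (d (d + 1))`,
by polarisation of the fourth moment. Applied once in each variable, this bounds the contribution by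
`(2 / (d (d + 1)))² ‖A‖² ‖B‖²` with Frobenius norms, and trace preservation fixes the sum of
`‖A‖² ‖B‖²` at `d²`.

For attainment, Carathéodory's theorem replaces the Haar average by a finite weighted 2-design. The
finite protocol that measures in the design, exchanges the outcomes and prepares them depends on the
design only through second moments in each variable, so it is exactly the integral channel, and
Cauchy–Schwarz is an equality for each of its rank-one Kraus operators. Passing to limits of LOCC
channels uses the same device: on a finite-dimensional space of channels the average fidelity is a
finite sum of point evaluations.
-/

/-! ### Unitarily invariant measures on the unit sphere -/

/-- The action of a linear isometry on the unit sphere. -/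
def sphereHomeomorph {𝕜 E : Type*} [NormedField 𝕜] [NormedAddCommGroup E] [NormedSpace 𝕜 E]
    (V : E ≃ₗᵢ[𝕜] E) : Metric.sphere (0 : E) 1 ≃ₜ Metric.sphere (0 : E) 1 :=
  V.toHomeomorph.subtype fun x => by simp

open scoped Pointwise in
theorem preimage_Ioo_smul_sphere {E : Type*} [NormedAddCommGroup E] [NormedSpace ℝ E]
    (V : E ≃ₗᵢ[ℝ] E) (s : Set (Metric.sphere (0 : E) 1)) :
    V ⁻¹' (Set.Ioo (0 : ℝ) 1 • (Subtype.val '' s)) =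
      Set.Ioo (0 : ℝ) 1 • (Subtype.val '' (sphereHomeomorph V ⁻¹' s)) := by
  ext x
  simp only [Set.mem_smul, Set.mem_image, Set.mem_preimage]
  constructor
  · rintro ⟨t, ht, _, ⟨y, hy, rfl⟩, h⟩
    refine ⟨t, ht, _, ⟨(sphereHomeomorph V).symm y, by simpa using hy, rfl⟩, V.injective ?_⟩
    simpa [sphereHomeomorph] using h
  · rintro ⟨t, ht, _, ⟨y, hy, rfl⟩, rfl⟩
    exact ⟨t, ht, _, ⟨_, hy, rfl⟩, by simp [sphereHomeomorph]⟩

theorem measurePreserving_sphereHomeomorph {E : Type*} [NormedAddCommGroup E]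
    [InnerProductSpace ℝ E] [FiniteDimensional ℝ E] [MeasurableSpace E] [BorelSpace E]
    (V : E ≃ₗᵢ[ℝ] E) :
    MeasurePreserving (sphereHomeomorph V) (volume : Measure E).toSphere
      (volume : Measure E).toSphere := by
  have hV := (sphereHomeomorph V).continuous.measurable
  refine ⟨hV, Measure.ext fun s hs => ?_⟩
  rw [Measure.map_apply hV hs, Measure.toSphere_apply' _ (hV hs), Measure.toSphere_apply' _ hs,
    ← preimage_Ioo_smul_sphere,
    V.measurePreserving.measure_preimage_emb V.toHomeomorph.measurableEmbedding]

theorem exists_linearIsometryEquiv_apply_eq {E : Type*} [NormedAddCommGroup E]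
    [InnerProductSpace ℂ E] [FiniteDimensional ℂ E] {u v : E} (hu : ‖u‖ = 1) (hv : ‖v‖ = 1) :
    ∃ U : E ≃ₗᵢ[ℂ] E, U u = v := by
  let e := LinearIsometryEquiv.toSpanUnitSingleton (𝕜 := ℂ) u hu
  let L : (ℂ ∙ u) →ₗᵢ[ℂ] E :=
    (LinearIsometry.toSpanSingleton ℂ E hv).comp e.symm.toLinearIsometry
  let u' : ℂ ∙ u := ⟨u, Submodule.mem_span_singleton_self u⟩
  have e_symm_apply : e.symm u' = 1 := by
    rw [LinearIsometryEquiv.symm_apply_eq]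
    ext
    simp [e, u']
  refine ⟨L.extend.toLinearIsometryEquiv rfl, ?_⟩
  calc L.extend u = L u' := L.extend_apply u'
    _ = v := by simp [L, e_symm_apply]

theorem sum_norm_add_I_pow_smul_pow_four {E : Type*} [NormedAddCommGroup E]
    [InnerProductSpace ℂ E] (u v : E) :
    ∑ k : Fin 4, ‖u + Complex.I ^ (k : ℕ) • v‖ ^ 4 =
      4 * (‖u‖ ^ 2 + ‖v‖ ^ 2) ^ 2 + 8 * ‖inner ℂ u v‖ ^ 2 := by
  have norm_pow_four (z : ℂ) (hz : ‖z‖ = 1) : ‖u + z • v‖ ^ 4 =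
      (‖u‖ ^ 2 + ‖v‖ ^ 2 + 2 * (z * inner ℂ u v).re) ^ 2 := by
    rw [show 4 = 2 * 2 by norm_num, pow_mul, norm_add_sq (𝕜 := ℂ), norm_smul, hz, inner_smul_right]
    simp only [RCLike.re_to_complex]
    ring
  rw [← Complex.normSq_eq_norm_sq, Complex.normSq_apply]
  simp only [norm_pow_four _ (show ‖Complex.I ^ _‖ = 1 by simp), Fin.sum_univ_four]
  simp only [pow_succ, pow_zero, one_mul, Fin.isValue, Fin.coe_ofNat_eq_mod, Nat.zero_mod,
    Nat.one_mod, Complex.mul_re, Complex.I_re, zero_mul, Complex.I_im, zero_sub, mul_neg,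
    Nat.reduceMod, Complex.I_mul_I, neg_mul, Complex.neg_re, Nat.mod_succ, neg_neg]
  ring

theorem integrable_of_continuous {X G : Type*} [TopologicalSpace X] [CompactSpace X]
    [MeasurableSpace X] [OpensMeasurableSpace X] {μ : Measure X} [IsFiniteMeasure μ]
    [NormedAddCommGroup G] {f : X → G} (hf : Continuous f) : Integrable f μ :=
  hf.integrable_of_hasCompactSupport (HasCompactSupport.of_compactSpace f)

section UnitarilyInvariant

variable {E : Type*} [NormedAddCommGroup E] [InnerProductSpace ℂ E] [MeasurableSpace E]

/-- A measure on the unit sphere of a complex inner product space is unitarily invariant if every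
unitary operator preserves it. -/
def IsUnitarilyInvariant (μ : Measure (Metric.sphere (0 : E) 1)) : Prop :=
  ∀ U : E ≃ₗᵢ[ℂ] E, MeasurePreserving (sphereHomeomorph U) μ μ

variable [BorelSpace E] {μ : Measure (Metric.sphere (0 : E) 1)}

theorem IsUnitarilyInvariant.integral_norm_inner_pow_apply (hμ : IsUnitarilyInvariant μ)
    (U : E ≃ₗᵢ[ℂ] E) (n : ℕ) (v : E) :
    ∫ ψ, ‖inner ℂ ψ.1 (U v)‖ ^ n ∂μ = ∫ ψ, ‖inner ℂ ψ.1 v‖ ^ n ∂μ := by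
  rw [← (hμ U).integral_comp (sphereHomeomorph U).measurableEmbedding]
  exact congrArg _ (funext fun ψ => congrArg (‖·‖ ^ n) (U.inner_map_map ψ.1 v))

variable [FiniteDimensional ℂ E]

theorem integrable_sphere_of_continuous [IsFiniteMeasure μ] {G : Type*} [NormedAddCommGroup G]
    {f : Metric.sphere (0 : E) 1 → G} (hf : Continuous f) : Integrable f μ :=
  have := FiniteDimensional.proper_rclike ℂ E
  integrable_of_continuous hf

theorem sum_integral_mul_sq_norm_inner [IsFiniteMeasure μ] {ι : Type*} [Fintype ι]
    (b : OrthonormalBasis ι ℂ E) {f : Metric.sphere (0 : E) 1 → ℝ} (hf : Continuous f) :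
    ∑ i, ∫ ψ, f ψ * ‖inner ℂ ψ.1 (b i)‖ ^ 2 ∂μ = ∫ ψ, f ψ ∂μ := by
  rw [← integral_finsetSum _ fun i _ => integrable_sphere_of_continuous (by fun_prop)]
  simp [← Finset.mul_sum, b.sum_sq_norm_inner_left]

namespace IsUnitarilyInvariant

theorem integral_norm_inner_pow (hμ : IsUnitarilyInvariant μ) {e : E} (he : ‖e‖ = 1) (n : ℕ)
    (v : E) :
    ∫ ψ, ‖inner ℂ ψ.1 v‖ ^ n ∂μ = ‖v‖ ^ n * ∫ ψ, ‖inner ℂ ψ.1 e‖ ^ n ∂μ := by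
  rcases eq_or_ne v 0 with rfl | hv
  · rcases eq_or_ne n 0 with rfl | hn <;> simp [*]
  have hv' : ‖(‖v‖ : ℂ)⁻¹ • v‖ = 1 := by simp [norm_smul, hv]
  obtain ⟨U, hU⟩ := exists_linearIsometryEquiv_apply_eq he hv'
  rw [← hμ.integral_norm_inner_pow_apply U n e, hU, ← integral_const_mul]
  simp [mul_pow, hv]

theorem integral_sq_norm_inner_mul_sq_norm_inner_eq_mul [IsFiniteMeasure μ]
    (hμ : IsUnitarilyInvariant μ) {e : E} (he : ‖e‖ = 1) (u v : E) :
    ∫ ψ, ‖inner ℂ ψ.1 u‖ ^ 2 * ‖inner ℂ ψ.1 v‖ ^ 2 ∂μ =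
      (‖u‖ ^ 2 * ‖v‖ ^ 2 + ‖inner ℂ u v‖ ^ 2) * ((∫ ψ, ‖inner ℂ ψ.1 e‖ ^ 4 ∂μ) / 2) := by
  have pointwise (ψ : Metric.sphere (0 : E) 1) :
      ‖inner ℂ ψ.1 u‖ ^ 2 * ‖inner ℂ ψ.1 v‖ ^ 2 =
        (∑ k : Fin 4, ‖inner ℂ ψ.1 (u + Complex.I ^ (k : ℕ) • v)‖ ^ 4 -
          4 * ‖inner ℂ ψ.1 u‖ ^ 4 - 4 * ‖inner ℂ ψ.1 v‖ ^ 4) / 16 := by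
    simp_rw [inner_add_right, inner_smul_right, ← smul_eq_mul (a := Complex.I ^ _),
      sum_norm_add_I_pow_smul_pow_four, RCLike.inner_apply, norm_mul, RCLike.norm_conj]
    ring
  simp_rw [pointwise]
  rw [integral_div, integral_sub, integral_sub, integral_finsetSum, integral_const_mul,
    integral_const_mul]
  · have fourth_moment := hμ.integral_norm_inner_pow he 4
    generalize ∫ ψ, ‖inner ℂ ψ.1 e‖ ^ 4 ∂μ = M at fourth_moment ⊢
    simp_rw [fourth_moment, ← Finset.sum_mul, sum_norm_add_I_pow_smul_pow_four]
    ring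
  all_goals intros; exact integrable_sphere_of_continuous (by fun_prop)

theorem integral_norm_inner_pow_four_of_norm_eq_one [IsProbabilityMeasure μ]
    (hμ : IsUnitarilyInvariant μ) {e : E} (he : ‖e‖ = 1) :
    ∫ ψ, ‖inner ℂ ψ.1 e‖ ^ 4 ∂μ =
      2 / (Module.finrank ℂ E * (Module.finrank ℂ E + 1)) := by
  have hn : (Module.finrank ℂ E : ℝ) ≠ 0 := by
    have : Nontrivial E := ⟨e, 0, by rintro rfl; simp at he⟩
    exact_mod_cast Module.finrank_pos.ne'
  let b := stdOrthonormalBasis ℂ E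
  have hsum : ∑ i, ∑ j, ∫ ψ, ‖inner ℂ ψ.1 (b i)‖ ^ 2 * ‖inner ℂ ψ.1 (b j)‖ ^ 2 ∂μ = 1 := by
    calc _ = ∑ i, ∫ ψ, 1 * ‖inner ℂ ψ.1 (b i)‖ ^ 2 ∂μ :=
          Finset.sum_congr rfl fun i _ => by
            rw [sum_integral_mul_sq_norm_inner b (by fun_prop)]
            simp only [one_mul]
      _ = 1 := by
          rw [sum_integral_mul_sq_norm_inner b (by fun_prop)]
          simp
  simp only [hμ.integral_sq_norm_inner_mul_sq_norm_inner_eq_mul he, ← Finset.sum_mul,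
    Finset.sum_add_distrib, b.sum_sq_norm_inner_left, b.norm_eq_one, one_pow, mul_one,
    Finset.sum_const, Finset.card_univ, Fintype.card_fin, nsmul_eq_mul] at hsum
  field_simp
  linarith

/-- The second-moment operator of the state is the normalised projection onto the symmetric
subspace; this is its expectation in `u ⊗ v`. -/
theorem integral_sq_norm_inner_mul_sq_norm_inner [IsProbabilityMeasure μ]
    (hμ : IsUnitarilyInvariant μ) (u v : E) :
    ∫ ψ, ‖inner ℂ ψ.1 u‖ ^ 2 * ‖inner ℂ ψ.1 v‖ ^ 2 ∂μ =
      (‖u‖ ^ 2 * ‖v‖ ^ 2 + ‖inner ℂ u v‖ ^ 2) /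
        (Module.finrank ℂ E * (Module.finrank ℂ E + 1)) := by
  obtain ⟨e, he⟩ : (Metric.sphere (0 : E) 1).Nonempty :=
    Set.nonempty_coe_sort.mp (nonempty_of_isProbabilityMeasure μ)
  have he : ‖e‖ = 1 := by simpa using he
  rw [hμ.integral_sq_norm_inner_mul_sq_norm_inner_eq_mul he,
    hμ.integral_norm_inner_pow_four_of_norm_eq_one he]
  ring

theorem integral_norm_inner_pow_four [IsProbabilityMeasure μ] (hμ : IsUnitarilyInvariant μ)
    (v : E) :
    ∫ ψ, ‖inner ℂ ψ.1 v‖ ^ 4 ∂μ =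
      2 / (Module.finrank ℂ E * (Module.finrank ℂ E + 1)) * ‖v‖ ^ 4 := by
  have h := hμ.integral_sq_norm_inner_mul_sq_norm_inner v v
  simp only [← pow_add] at h
  rw [h, inner_self_eq_norm_sq_to_K, norm_pow, RCLike.norm_ofReal, abs_norm]
  ring

theorem integral_sq_norm_inner_mul_sq_norm_inner_le [IsProbabilityMeasure μ]
    (hμ : IsUnitarilyInvariant μ) (u v : E) :
    ∫ ψ, ‖inner ℂ ψ.1 u‖ ^ 2 * ‖inner ℂ ψ.1 v‖ ^ 2 ∂μ ≤
      2 / (Module.finrank ℂ E * (Module.finrank ℂ E + 1)) * (‖u‖ ^ 2 * ‖v‖ ^ 2) := by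
  have h : ‖inner ℂ u v‖ ^ 2 ≤ ‖u‖ ^ 2 * ‖v‖ ^ 2 := by
    rw [← mul_pow]
    gcongr
    exact norm_inner_le_norm u v
  rw [hμ.integral_sq_norm_inner_mul_sq_norm_inner, div_mul_eq_mul_div]
  gcongr
  linarith

theorem integral_sq_norm_inner [IsProbabilityMeasure μ] (hμ : IsUnitarilyInvariant μ) (v : E) :
    ∫ ψ, ‖inner ℂ ψ.1 v‖ ^ 2 ∂μ = ‖v‖ ^ 2 / Module.finrank ℂ E := by
  have h := sum_integral_mul_sq_norm_inner (μ := μ) (stdOrthonormalBasis ℂ E)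
    (f := fun ψ => ‖inner ℂ ψ.1 v‖ ^ 2) (by fun_prop)
  rw [← h]
  simp only [hμ.integral_sq_norm_inner_mul_sq_norm_inner, ← Finset.sum_div,
    Finset.sum_add_distrib, OrthonormalBasis.sum_sq_norm_inner_left,
    OrthonormalBasis.norm_eq_one, one_pow, mul_one, Finset.sum_const, Finset.card_univ,
    Fintype.card_fin, nsmul_eq_mul]
  field_simp

end IsUnitarilyInvariant
end UnitarilyInvariant

theorem isUnitarilyInvariant_haarState (d : ℕ) : IsUnitarilyInvariant (haarState d) := fun U =>
  let V : EuclideanSpace ℂ (Fin d) ≃ₗᵢ[ℝ] EuclideanSpace ℂ (Fin d) :=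
    ⟨U.toLinearEquiv.restrictScalars ℝ, U.norm_map⟩
  (measurePreserving_sphereHomeomorph V).smul_measure _

instance isProbabilityMeasure_haarState {d : ℕ} [NeZero d] :
    IsProbabilityMeasure (haarState d) := by
  have : NeZero (volume : Measure (EuclideanSpace ℂ (Fin d))).toSphere :=
    ⟨Measure.toSphere_ne_zero _⟩
  unfold haarState
  infer_instance

/-! ### Quadrature -/

/-- By Carathéodory's theorem it suffices to take convex combinations of boundedly many points. -/
theorem isCompact_convexHull_of_finiteDimensional {E : Type*} [AddCommGroup E] [Module ℝ E]
    [TopologicalSpace E] [ContinuousAdd E] [ContinuousSMul ℝ E] [FiniteDimensional ℝ E]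
    {s : Set E} (hs : IsCompact s) : IsCompact (convexHull ℝ s) := by
  let combination (n : ℕ) (p : (Fin n → ℝ) × (Fin n → E)) : E := ∑ i, p.1 i • p.2 i
  let K (n : ℕ) : Set ((Fin n → ℝ) × (Fin n → E)) := stdSimplex ℝ (Fin n) ×ˢ Set.univ.pi fun _ => s
  have hK (n : ℕ) : IsCompact (combination n '' K n) :=
    ((isCompact_stdSimplex ℝ _).prod (isCompact_univ_pi fun _ => hs)).image (by fun_prop)
  convert! (Set.finite_Iic (Module.finrank ℝ E + 1)).isCompact_biUnion fun n _ => hK n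
  apply subset_antisymm
  · intro x hx
    obtain ⟨ι, _, z, w, hz, hind, hw, hw1, rfl⟩ := eq_pos_convex_span_of_mem_convexHull hx
    let e := (Fintype.equivFin ι).symm
    refine Set.mem_biUnion (x := Fintype.card ι)
      (hind.card_le_finrank_succ.trans <| Nat.succ_le_succ <| Submodule.finrank_le _)
      ⟨(w ∘ e, z ∘ e), ⟨⟨fun i => (hw _).le, ?_⟩, fun i _ => hz ⟨e i, rfl⟩⟩, ?_⟩
    · exact (e.sum_comp w).trans hw1
    · exact e.sum_comp fun i => w i • z i
  · refine Set.iUnion₂_subset fun n _ => ?_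
    rintro _ ⟨⟨w, z⟩, ⟨hw, hz⟩, rfl⟩
    exact (convex_convexHull ℝ s).sum_mem (fun i _ => hw.1 i) hw.2
      fun i _ => subset_convexHull ℝ s (hz i trivial)

/-- The mean of the continuous curve `ω ↦ (Φ (b i) ω)_i`, `b` a basis of `V`, lies in the convex
hull of its compact range. -/
theorem exists_quadrature {X V : Type*} [TopologicalSpace X] [CompactSpace X]
    [MeasurableSpace X] [OpensMeasurableSpace X] (μ : Measure X) [IsProbabilityMeasure μ]
    [AddCommGroup V] [Module ℂ V] [FiniteDimensional ℂ V] (Φ : V →ₗ[ℂ] C(X, ℂ)) :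
    ∃ (n : ℕ) (w : Fin n → ℝ) (x : Fin n → X), (∀ s, 0 ≤ w s) ∧
      ∀ v, ∫ ω, Φ v ω ∂μ = ∑ s, w s * Φ v (x s) := by
  let b := Module.finBasis ℂ V
  let F (ω : X) : Fin (Module.finrank ℂ V) → ℂ := fun i => Φ (b i) ω
  have hF : Continuous F := by fun_prop
  have mean_mem : ∫ ω, F ω ∂μ ∈ convexHull ℝ (Set.range F) :=
    (convex_convexHull ℝ _).integral_mem
      (isCompact_convexHull_of_finiteDimensional (isCompact_range hF)).isClosed
      (.of_forall fun ω => subset_convexHull ℝ _ ⟨ω, rfl⟩) (integrable_of_continuous hF)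
  obtain ⟨ι, _, w, z, hw, -, hz, hsum⟩ := mem_convexHull_iff_exists_fintype.1 mean_mem
  choose x hx using hz
  have hb (i) : ∫ ω, Φ (b i) ω ∂μ = ∑ s, w s * Φ (b i) (x s) := by
    have h := congrFun hsum i
    rw [eval_integral fun i => integrable_of_continuous (by fun_prop)] at h
    rw [← h]
    simp [← hx, F]
  let e := (Fintype.equivFin ι).symm
  refine ⟨Fintype.card ι, w ∘ e, x ∘ e, fun s => hw _, fun v => ?_⟩
  simp only [Function.comp_apply, e.sum_comp fun s => (w s : ℂ) * Φ v (x s)]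
  rw [← b.sum_repr v]
  simp only [map_sum, map_smul, ContinuousMap.coe_sum, ContinuousMap.coe_smul, Finset.sum_apply,
    Pi.smul_apply, smul_eq_mul, Finset.mul_sum]
  rw [integral_finsetSum _ fun i _ => integrable_of_continuous (by fun_prop), Finset.sum_comm]
  simp only [integral_const_mul, hb, Finset.mul_sum, mul_left_comm]

theorem integral_prod_eq_sum_sum {X Y : Type*} [TopologicalSpace X] [CompactSpace X]
    [MeasurableSpace X] [OpensMeasurableSpace X] [TopologicalSpace Y] [CompactSpace Y]
    [MeasurableSpace Y] [OpensMeasurableSpace (X × Y)] {μ : Measure X} {ν : Measure Y}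
    [IsFiniteMeasure μ] [IsFiniteMeasure ν] {f : X → Y → ℂ} (hf : Continuous f.uncurry) {m n : ℕ}
    {v : Fin m → ℝ} {w : Fin n → ℝ} {x : Fin m → X} {y : Fin n → Y}
    (hfst : ∀ b, ∫ a, f a b ∂μ = ∑ s, v s * f (x s) b)
    (hsnd : ∀ a, ∫ b, f a b ∂ν = ∑ t, w t * f a (y t)) :
    ∫ ω, f ω.1 ω.2 ∂μ.prod ν = ∑ s, ∑ t, v s * w t * f (x s) (y t) := by
  have summand_continuous (t) : Continuous fun a => w t * f a (y t) :=
    continuous_const.mul (hf.comp (continuous_id.prodMk continuous_const))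
  calc ∫ ω, f.uncurry ω ∂μ.prod ν
      = ∫ a, ∑ t, w t * f a (y t) ∂μ := by
        rw [integral_prod _ (integrable_of_continuous hf)]
        simp only [Function.uncurry_apply_pair, hsnd]
    _ = ∑ t, w t * ∫ a, f a (y t) ∂μ := by
        rw [integral_finsetSum _ fun t _ => integrable_of_continuous (summand_continuous t)]
        simp only [integral_const_mul]
    _ = ∑ s, ∑ t, v s * w t * f (x s) (y t) := by
        simp only [hfst, Finset.mul_sum]
        rw [Finset.sum_comm]
        simp only [mul_left_comm, mul_assoc]

section Bilinear

variable {X E F : Type*} [TopologicalSpace X]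
  [AddCommGroup E] [Module ℂ E] [TopologicalSpace E] [IsTopologicalAddGroup E]
  [ContinuousSMul ℂ E] [T2Space E] [FiniteDimensional ℂ E]
  [AddCommGroup F] [Module ℂ F] [TopologicalSpace F] [IsTopologicalAddGroup F]
  [ContinuousSMul ℂ F] [T2Space F] [FiniteDimensional ℂ F]
  {ρ : X → E} {σ : X → F}

theorem continuous_bilinear_apply (β : E →ₗ[ℂ] F →ₗ[ℂ] ℂ) (hρ : Continuous ρ)
    (hσ : Continuous σ) : Continuous fun ω => β (ρ ω) (σ ω) := by
  let b := Module.finBasis ℂ E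
  have coord_continuous (i) : Continuous fun ω => b.coord i (ρ ω) :=
    (b.coord i).continuous_of_finiteDimensional.comp hρ
  have apply_continuous (i) : Continuous fun ω => β (b i) (σ ω) :=
    (β (b i)).continuous_of_finiteDimensional.comp hσ
  have expansion (ω) : β (ρ ω) (σ ω) = ∑ i, b.coord i (ρ ω) * β (b i) (σ ω) := by
    conv_lhs => rw [← b.sum_repr (ρ ω)]
    simp only [map_sum, map_smul, LinearMap.sum_apply, LinearMap.smul_apply, smul_eq_mul,
      Module.Basis.coord_apply]
  simp only [expansion]
  exact continuous_finsetSum _ fun i _ => (coord_continuous i).mul (apply_continuous i)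

theorem exists_bilinear_quadrature [CompactSpace X] [MeasurableSpace X] [OpensMeasurableSpace X]
    (μ : Measure X) [IsProbabilityMeasure μ] (hρ : Continuous ρ) (hσ : Continuous σ) :
    ∃ (n : ℕ) (w : Fin n → ℝ) (x : Fin n → X), (∀ s, 0 ≤ w s) ∧
      ∀ β : E →ₗ[ℂ] F →ₗ[ℂ] ℂ, ∫ ω, β (ρ ω) (σ ω) ∂μ = ∑ s, w s * β (ρ (x s)) (σ (x s)) :=
  exists_quadrature μ
    { toFun β := ⟨fun ω => β (ρ ω) (σ ω), continuous_bilinear_apply β hρ hσ⟩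
      map_add' _ _ := rfl
      map_smul' _ _ := rfl }

end Bilinear

theorem continuous_pureState {ι : Type*} :
    Continuous (pureState : EuclideanSpace ℂ ι → Matrix ι ι ℂ) := by
  refine continuous_matrix fun i j => ?_
  simp only [pureState, Matrix.vecMulVec_apply]
  fun_prop

/-- The bilinear form `(X, Y) ↦ Tr[Λ(X) Y]`, whose values on pairs of pure states are
fidelities. -/
def traceForm {a b : Type*} [Fintype b] (Λ : Matrix a a ℂ →ₗ[ℂ] Matrix b b ℂ) :
    Matrix a a ℂ →ₗ[ℂ] Matrix b b ℂ →ₗ[ℂ] ℂ :=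
  (LinearMap.mul ℂ (Matrix b b ℂ)).compr₂ (Matrix.traceLinearMap b ℂ ℂ) ∘ₗ Λ

theorem averageFidelity_eq_re_integral {Ω : Type*} [MeasurableSpace Ω] {m n m' n' : ℕ}
    [TopologicalSpace Ω] [CompactSpace Ω] [OpensMeasurableSpace Ω] {μ : Measure Ω}
    [IsFiniteMeasure μ] {ψ : Ω → EuclideanSpace ℂ (Fin m × Fin n)} (hψ : Continuous ψ)
    (U : EuclideanSpace ℂ (Fin m × Fin n) →ₗᵢ[ℂ] EuclideanSpace ℂ (Fin m' × Fin n'))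
    (Λ : Matrix (Fin m × Fin n) (Fin m × Fin n) ℂ →ₗ[ℂ]
      Matrix (Fin m' × Fin n') (Fin m' × Fin n') ℂ) :
    averageFidelity μ ψ U Λ =
      (∫ ω, traceForm Λ (pureState (ψ ω)) (pureState (U (ψ ω))) ∂μ).re :=
  integral_re <| integrable_of_continuous <| continuous_bilinear_apply (traceForm Λ)
    (continuous_pureState.comp hψ) (continuous_pureState.comp (U.continuous.comp hψ))

theorem tendsto_averageFidelity {Ω : Type*} [MeasurableSpace Ω] {m n m' n' : ℕ}
    [TopologicalSpace Ω] [CompactSpace Ω] [OpensMeasurableSpace Ω] (μ : Measure Ω)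
    [IsProbabilityMeasure μ] {ψ : Ω → EuclideanSpace ℂ (Fin m × Fin n)} (hψ : Continuous ψ)
    (U : EuclideanSpace ℂ (Fin m × Fin n) →ₗᵢ[ℂ] EuclideanSpace ℂ (Fin m' × Fin n'))
    {ι : Type*} {l : Filter ι} {Λs : ι → Matrix (Fin m × Fin n) (Fin m × Fin n) ℂ →ₗ[ℂ]
      Matrix (Fin m' × Fin n') (Fin m' × Fin n') ℂ}
    {Λ : Matrix (Fin m × Fin n) (Fin m × Fin n) ℂ →ₗ[ℂ]
      Matrix (Fin m' × Fin n') (Fin m' × Fin n') ℂ}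
    (h : ∀ X, Filter.Tendsto (fun t => Λs t X) l (nhds (Λ X))) :
    Filter.Tendsto (fun t => averageFidelity μ ψ U (Λs t)) l
      (nhds (averageFidelity μ ψ U Λ)) := by
  obtain ⟨N, w, x, -, hx⟩ := exists_bilinear_quadrature μ (continuous_pureState.comp hψ)
    (continuous_pureState.comp (U.continuous.comp hψ))
  have trace_tendsto (X Y) : Filter.Tendsto (fun t => traceForm (Λs t) X Y) l
      (nhds (traceForm Λ X Y)) :=
    ((continuous_id.matrix_mul continuous_const).matrix_trace.tendsto _).comp (h X)
  simp only [Function.comp_apply] at hx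
  simp only [averageFidelity_eq_re_integral hψ, hx]
  exact (Complex.continuous_re.tendsto _).comp
    (tendsto_finsetSum _ fun s _ => (trace_tendsto _ _).const_mul _)

/-! ### Product Kraus operators and the upper bound -/

section FidelityBound

open Module (finrank)

variable {E F : Type*} [NormedAddCommGroup E] [InnerProductSpace ℂ E] [FiniteDimensional ℂ E]
  [NormedAddCommGroup F] [InnerProductSpace ℂ F] [FiniteDimensional ℂ F]

theorem sq_norm_apply_eq_sum_sq_norm_inner_adjoint {ι : Type*} [Fintype ι]
    (b : OrthonormalBasis ι ℂ F) (A : E →ₗ[ℂ] F) (ψ : E) :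
    ‖A ψ‖ ^ 2 = ∑ i, ‖inner ℂ ψ (A.adjoint (b i))‖ ^ 2 := by
  simp only [LinearMap.adjoint_inner_right, b.sum_sq_norm_inner_left]

variable [MeasurableSpace E] [BorelSpace E] {μ : Measure (Metric.sphere (0 : E) 1)}
  [IsProbabilityMeasure μ]

theorem IsUnitarilyInvariant.integral_sq_norm_apply_mul_sq_norm_apply_le
    (hμ : IsUnitarilyInvariant μ) {ι : Type*} [Fintype ι] (b : OrthonormalBasis ι ℂ F)
    (A C : E →ₗ[ℂ] F) :
    ∫ ψ, ‖A ψ.1‖ ^ 2 * ‖C ψ.1‖ ^ 2 ∂μ ≤ 2 / (finrank ℂ E * (finrank ℂ E + 1)) *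
      ((∑ i, ‖A.adjoint (b i)‖ ^ 2) * ∑ j, ‖C.adjoint (b j)‖ ^ 2) := by
  simp only [sq_norm_apply_eq_sum_sq_norm_inner_adjoint b, Finset.sum_mul_sum]
  rw [integral_finsetSum _ fun i _ => integrable_sphere_of_continuous (by fun_prop),
    Finset.mul_sum]
  refine Finset.sum_le_sum fun i _ => ?_
  rw [integral_finsetSum _ fun j _ => integrable_sphere_of_continuous (by fun_prop),
    Finset.mul_sum]
  exact Finset.sum_le_sum fun j _ => hμ.integral_sq_norm_inner_mul_sq_norm_inner_le _ _

variable [MeasurableSpace F] [BorelSpace F] {ν : Measure (Metric.sphere (0 : F) 1)}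
  [IsProbabilityMeasure ν]

theorem integrable_sq_norm_inner_apply_mul_sq_norm_inner_apply
    (P : Measure (Metric.sphere (0 : E) 1 × Metric.sphere (0 : F) 1)) [IsFiniteMeasure P]
    (A : E →ₗ[ℂ] F) (B : F →ₗ[ℂ] E) :
    Integrable (fun ω => ‖inner ℂ ω.2.1 (A ω.1.1)‖ ^ 2 * ‖inner ℂ ω.1.1 (B ω.2.1)‖ ^ 2) P := by
  have := FiniteDimensional.proper_rclike ℂ E
  have := FiniteDimensional.proper_rclike ℂ F
  have hA := A.continuous_of_finiteDimensional
  have hB := B.continuous_of_finiteDimensional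
  exact integrable_of_continuous (by fun_prop)

theorem IsUnitarilyInvariant.integral_prod_sq_norm_inner_apply_mul_le
    (hμ : IsUnitarilyInvariant μ) (hν : IsUnitarilyInvariant ν) {ι : Type*} [Fintype ι]
    (b : OrthonormalBasis ι ℂ F) (A : E →ₗ[ℂ] F) (B : F →ₗ[ℂ] E) :
    ∫ ω, ‖inner ℂ ω.2.1 (A ω.1.1)‖ ^ 2 * ‖inner ℂ ω.1.1 (B ω.2.1)‖ ^ 2 ∂μ.prod ν ≤
      2 / (finrank ℂ E * (finrank ℂ E + 1)) * (2 / (finrank ℂ F * (finrank ℂ F + 1))) *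
        ((∑ i, ‖A.adjoint (b i)‖ ^ 2) * ∑ j, ‖B (b j)‖ ^ 2) := by
  have hA := A.continuous_of_finiteDimensional
  have hB := B.adjoint.continuous_of_finiteDimensional
  have integrable :=
    integrable_sq_norm_inner_apply_mul_sq_norm_inner_apply (μ.prod ν) A B
  have inner_integral_le (ψ : Metric.sphere (0 : E) 1) :
      ∫ φ, ‖inner ℂ φ.1 (A ψ.1)‖ ^ 2 * ‖inner ℂ ψ.1 (B φ.1)‖ ^ 2 ∂ν ≤
        2 / (finrank ℂ F * (finrank ℂ F + 1)) * (‖A ψ.1‖ ^ 2 * ‖B.adjoint ψ.1‖ ^ 2) := by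
    refine le_of_eq_of_le ?_ (hν.integral_sq_norm_inner_mul_sq_norm_inner_le _ _)
    simp only [LinearMap.adjoint_inner_right, norm_inner_symm ψ.1]
  rw [integral_prod _ integrable]
  refine (integral_mono integrable.integral_prod_left
    (integrable_sphere_of_continuous (by fun_prop)) inner_integral_le).trans ?_
  rw [integral_const_mul, mul_comm (2 / (finrank ℂ E * _ : ℝ)), mul_assoc]
  gcongr
  simpa only [LinearMap.adjoint_adjoint] using
    hμ.integral_sq_norm_apply_mul_sq_norm_apply_le b A B.adjoint

end FidelityBound

section Kraus

open scoped Kronecker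

variable {a b c : Type*}

/-- The completely positive map `X ↦ K X K†` with Kraus operator `K`. -/
def krausMap [Fintype a] (K : Matrix b a ℂ) : Matrix a a ℂ →ₗ[ℂ] Matrix b b ℂ where
  toFun X := K * X * K.conjTranspose
  map_add' X Y := by rw [Matrix.mul_add, Matrix.add_mul]
  map_smul' c X := by simp

theorem krausMap_apply [Fintype a] (K : Matrix b a ℂ) (X : Matrix a a ℂ) :
    krausMap K X = K * X * K.conjTranspose := rfl

theorem krausMap_one [Fintype a] [DecidableEq a] :
    krausMap (1 : Matrix a a ℂ) = LinearMap.id := by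
  ext1 X
  simp [krausMap_apply]

theorem krausMap_comp_krausMap [Fintype a] [Fintype b] (L : Matrix c b ℂ) (K : Matrix b a ℂ) :
    krausMap L ∘ₗ krausMap K = krausMap (L * K) := by
  ext1 X
  simp only [LinearMap.comp_apply, krausMap_apply, Matrix.conjTranspose_mul, Matrix.mul_assoc]

theorem sum_krausMap_comp_sum_krausMap [Fintype a] [Fintype b] {ι κ : Type*} [Fintype ι]
    [Fintype κ] (L : ι → Matrix c b ℂ) (K : κ → Matrix b a ℂ) :
    (∑ t, krausMap (L t)) ∘ₗ (∑ s, krausMap (K s)) = ∑ t, ∑ s, krausMap (L t * K s) := by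
  ext1 X
  simp only [LinearMap.comp_apply, LinearMap.sum_apply, map_sum, ← krausMap_comp_krausMap]
  exact Finset.sum_comm

theorem sum_krausMap_comp_krausMap [Fintype a] [Fintype b] {ι : Type*} [Fintype ι]
    (L : ι → Matrix c b ℂ) (K : Matrix b a ℂ) :
    (∑ t, krausMap (L t)) ∘ₗ krausMap K = ∑ t, krausMap (L t * K) := by
  simpa using sum_krausMap_comp_sum_krausMap L fun _ : Unit => K

theorem onFst_krausMap [Fintype a] [Fintype c] [DecidableEq c] (K : Matrix b a ℂ) :
    onFst (krausMap K) = krausMap (K ⊗ₖ (1 : Matrix c c ℂ)) := by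
  ext X ⟨p1, p2⟩ ⟨q1, q2⟩
  simp [onFst, krausMap_apply, Matrix.mul_apply, Fintype.sum_prod_type, Matrix.one_apply,
    apply_ite (starRingEnd ℂ)]

theorem onSnd_krausMap [Fintype a] [Fintype c] [DecidableEq c] (K : Matrix b a ℂ) :
    onSnd (krausMap K) = krausMap ((1 : Matrix c c ℂ) ⊗ₖ K) := by
  ext X ⟨p1, p2⟩ ⟨q1, q2⟩
  simp [onSnd, krausMap_apply, Matrix.mul_apply, Fintype.sum_prod_type_right, Matrix.one_apply,
    apply_ite (starRingEnd ℂ)]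

theorem onFst_sum {ι : Type*} [Fintype ι] (E : ι → Matrix a a ℂ →ₗ[ℂ] Matrix b b ℂ) :
    (onFst (∑ i, E i) : Matrix (a × c) (a × c) ℂ →ₗ[ℂ] _) = ∑ i, onFst (E i) := by
  ext1 X
  ext p q
  simp [onFst, Matrix.sum_apply]

theorem onSnd_sum {ι : Type*} [Fintype ι] (E : ι → Matrix a a ℂ →ₗ[ℂ] Matrix b b ℂ) :
    (onSnd (∑ i, E i) : Matrix (c × a) (c × a) ℂ →ₗ[ℂ] _) = ∑ i, onSnd (E i) := by
  ext1 X
  ext p q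
  simp [onSnd, Matrix.sum_apply]

theorem isCompletelyPositive_krausMap {m m' : ℕ} (K : Matrix (Fin m') (Fin m) ℂ) :
    IsCompletelyPositive (krausMap K) := by
  intro k X hX
  rw [onFst_krausMap]
  exact hX.mul_mul_conjTranspose_same _

/-- The Kraus operators are read off from a rank-one decomposition of the Choi matrix. -/
theorem IsCompletelyPositive.exists_eq_sum_krausMap {m m' : ℕ}
    {E : Matrix (Fin m) (Fin m) ℂ →ₗ[ℂ] Matrix (Fin m') (Fin m') ℂ}
    (hE : IsCompletelyPositive E) :
    ∃ (N : ℕ) (K : Fin N → Matrix (Fin m') (Fin m) ℂ), E = ∑ t, krausMap (K t) := by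
  let ω : Fin m × Fin m → ℂ := fun p => (1 : Matrix (Fin m) (Fin m) ℂ) p.1 p.2
  obtain ⟨N, v, hv⟩ := Matrix.posSemidef_iff_eq_sum_vecMulVec.1
    (hE m _ (Matrix.posSemidef_vecMulVec_self_star ω))
  refine ⟨N, fun t => Matrix.of fun p i => v t (p, i), Matrix.ext_linearMap _ fun i j => ?_⟩
  ext1
  have block : (Matrix.of fun i' j' => Matrix.vecMulVec ω (star ω) (i', i) (j', j)) =
      Matrix.single i j 1 := by
    ext i' j'
    simp only [Matrix.single_apply, Matrix.of_apply, Matrix.vecMulVec_apply, Pi.star_apply, ω]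
    by_cases h1 : i = i' <;> by_cases h2 : j = j' <;> simp [Matrix.one_apply, h1, h2, eq_comm]
  ext p q
  have choi : E (Matrix.single i j 1) p q = ∑ t, v t (p, i) * star (v t (q, j)) := by
    rw [← block]
    exact (congrFun (congrFun hv (p, i)) (q, j)).trans (Matrix.sum_apply _ _ _ _)
  simp [choi, krausMap_apply, Matrix.sum_apply, Matrix.mul_apply, Matrix.single_apply, ite_and]

theorem IsLOCC.exists_eq_sum_krausMap_kronecker {m n m' n' : ℕ}
    {Λ : Matrix (Fin m × Fin n) (Fin m × Fin n) ℂ →ₗ[ℂ]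
      Matrix (Fin m' × Fin n') (Fin m' × Fin n') ℂ} (hΛ : IsLOCC Λ) :
    ∃ (ι : Type) (_ : Fintype ι) (A : ι → Matrix (Fin m') (Fin m) ℂ)
      (B : ι → Matrix (Fin n') (Fin n) ℂ), Λ = ∑ t, krausMap (A t ⊗ₖ B t) := by
  induction hΛ with
  | idle => exact ⟨Unit, inferInstance, fun _ => 1, fun _ => 1, by simp [krausMap_one]⟩
  | first E hE Λ _ ih =>
    choose ι hι A B hAB using ih
    choose N K hK using fun i => (hE.completelyPositive i).exists_eq_sum_krausMap
    refine ⟨(i : _) × (ι i × Fin (N i)), inferInstance, fun t => A t.1 t.2.1 * K t.1 t.2.2,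
      fun t => B t.1 t.2.1, ?_⟩
    simp only [Fintype.sum_sigma, Fintype.sum_prod_type]
    refine Finset.sum_congr rfl fun i _ => ?_
    simp only [hAB i, hK i, onFst_sum, onFst_krausMap, sum_krausMap_comp_sum_krausMap,
      ← Matrix.mul_kronecker_mul, Matrix.mul_one]
  | second E hE Λ _ ih =>
    choose ι hι A B hAB using ih
    choose N K hK using fun i => (hE.completelyPositive i).exists_eq_sum_krausMap
    refine ⟨(i : _) × (ι i × Fin (N i)), inferInstance, fun t => A t.1 t.2.1,
      fun t => B t.1 t.2.1 * K t.1 t.2.2, ?_⟩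
    simp only [Fintype.sum_sigma, Fintype.sum_prod_type]
    refine Finset.sum_congr rfl fun i _ => ?_
    simp only [hAB i, hK i, onSnd_sum, onSnd_krausMap, sum_krausMap_comp_sum_krausMap,
      ← Matrix.mul_kronecker_mul, Matrix.mul_one]

theorem IsInstrument.sum_trace_onFst {m k : ℕ} {r : Fin k → ℕ}
    {E : ∀ i, Matrix (Fin m) (Fin m) ℂ →ₗ[ℂ] Matrix (Fin (r i)) (Fin (r i)) ℂ}
    (hE : IsInstrument E) [Fintype b] (X : Matrix (Fin m × b) (Fin m × b) ℂ) :
    ∑ i, (onFst (E i) X).trace = X.trace := by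
  have trace_onFst (i) : (onFst (E i) X).trace =
      ∑ c, (E i (Matrix.of fun i j => X (i, c) (j, c))).trace := by
    simp only [Matrix.trace, Matrix.diag_apply, Fintype.sum_prod_type_right]
    rfl
  simp only [trace_onFst]
  rw [Finset.sum_comm]
  simp only [hE.tracePreserving]
  simp [Matrix.trace, Fintype.sum_prod_type_right]

theorem IsInstrument.sum_trace_onSnd {m k : ℕ} {r : Fin k → ℕ}
    {E : ∀ i, Matrix (Fin m) (Fin m) ℂ →ₗ[ℂ] Matrix (Fin (r i)) (Fin (r i)) ℂ}
    (hE : IsInstrument E) [Fintype b] (X : Matrix (b × Fin m) (b × Fin m) ℂ) :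
    ∑ i, (onSnd (E i) X).trace = X.trace := by
  have trace_onSnd (i) : (onSnd (E i) X).trace =
      ∑ c, (E i (Matrix.of fun i j => X (c, i) (c, j))).trace := by
    simp only [Matrix.trace, Matrix.diag_apply, Fintype.sum_prod_type]
    rfl
  simp only [trace_onSnd]
  rw [Finset.sum_comm]
  simp only [hE.tracePreserving]
  simp [Matrix.trace, Fintype.sum_prod_type]

theorem IsLOCC.trace_apply {m n m' n' : ℕ}
    {Λ : Matrix (Fin m × Fin n) (Fin m × Fin n) ℂ →ₗ[ℂ]
      Matrix (Fin m' × Fin n') (Fin m' × Fin n') ℂ} (hΛ : IsLOCC Λ)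
    (X : Matrix (Fin m × Fin n) (Fin m × Fin n) ℂ) : (Λ X).trace = X.trace := by
  induction hΛ with
  | idle => rfl
  | first E hE Λ _ ih => simp [Matrix.trace_sum, ih, hE.sum_trace_onFst]
  | second E hE Λ _ ih => simp [Matrix.trace_sum, ih, hE.sum_trace_onSnd]

end Kraus

section Frobenius
open scoped Kronecker Matrix.Norms.Frobenius

variable {a b c e : Type*} [Fintype a] [Fintype b] [Fintype c] [Fintype e]

theorem sq_frobenius_norm_eq_sum (A : Matrix a b ℂ) : ‖A‖ ^ 2 = ∑ i, ∑ j, ‖A i j‖ ^ 2 := by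
  rw [Matrix.frobenius_norm_def, ← Real.rpow_natCast, ← Real.rpow_mul (by positivity)]
  simp

theorem frobenius_norm_kronecker (A : Matrix a b ℂ) (B : Matrix c e ℂ) :
    ‖A ⊗ₖ B‖ = ‖A‖ * ‖B‖ := by
  rw [← sq_eq_sq₀ (norm_nonneg _) (by positivity), mul_pow]
  simp only [sq_frobenius_norm_eq_sum, Fintype.sum_prod_type, Matrix.kroneckerMap_apply, norm_mul,
    mul_pow, Finset.sum_mul_sum]

theorem trace_krausMap_one [DecidableEq a] (K : Matrix b a ℂ) :
    (krausMap K 1).trace = (‖K‖ ^ 2 : ℝ) := by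
  simp [krausMap_apply, Matrix.trace, Matrix.mul_apply, sq_frobenius_norm_eq_sum, Complex.mul_conj']

theorem IsLOCC.sum_sq_norm_mul_sq_norm {m n m' n' : ℕ} {ι : Type*} [Fintype ι]
    {A : ι → Matrix (Fin m') (Fin m) ℂ} {B : ι → Matrix (Fin n') (Fin n) ℂ}
    (h : IsLOCC (∑ t, krausMap (A t ⊗ₖ B t))) : ∑ t, ‖A t‖ ^ 2 * ‖B t‖ ^ 2 = m * n := by
  have trace_one := h.trace_apply 1
  simp only [LinearMap.sum_apply, Matrix.trace_sum, trace_krausMap_one, frobenius_norm_kronecker,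
    Matrix.trace_one, Fintype.card_prod, Fintype.card_fin, mul_pow] at trace_one
  exact_mod_cast trace_one

theorem sum_sq_norm_toEuclideanLin_basisFun [DecidableEq b] (A : Matrix a b ℂ) :
    ∑ j, ‖A.toEuclideanLin (EuclideanSpace.basisFun b ℂ j)‖ ^ 2 = ‖A‖ ^ 2 := by
  rw [sq_frobenius_norm_eq_sum, Finset.sum_comm]
  simp [EuclideanSpace.norm_sq_eq]
end Frobenius

section KetBra

open scoped Kronecker

variable {a b c e : Type*}

/-- The rank-one operator `|x⟩⟨u|`. -/
def ketBra (x : EuclideanSpace ℂ b) (u : EuclideanSpace ℂ a) : Matrix b a ℂ :=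
  Matrix.vecMulVec x.ofLp (star u.ofLp)

theorem ketBra_self (x : EuclideanSpace ℂ a) : ketBra x x = pureState x := rfl

theorem conjTranspose_ketBra (x : EuclideanSpace ℂ b) (u : EuclideanSpace ℂ a) :
    (ketBra x u).conjTranspose = ketBra u x := by
  rw [ketBra, Matrix.conjTranspose_vecMulVec, star_star, ketBra]

theorem ketBra_mul_ketBra [Fintype a] (x : EuclideanSpace ℂ b) (u v : EuclideanSpace ℂ a)
    (y : EuclideanSpace ℂ c) : ketBra x u * ketBra v y = inner ℂ u v • ketBra x y := by
  rw [ketBra, ketBra, Matrix.vecMulVec_mul_vecMulVec, Matrix.vecMulVec_smul, ketBra,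
    EuclideanSpace.inner_eq_star_dotProduct, dotProduct_comm]

theorem trace_ketBra [Fintype a] (x u : EuclideanSpace ℂ a) :
    (ketBra x u).trace = inner ℂ u x :=
  Matrix.trace_vecMulVec _ _

theorem trace_pureState [Fintype a] (x : EuclideanSpace ℂ a) :
    (pureState x).trace = ‖x‖ ^ 2 := by
  rw [← ketBra_self, trace_ketBra, inner_self_eq_norm_sq_to_K]
  rfl

theorem toEuclideanLin_ketBra [Fintype a] [DecidableEq a] (x : EuclideanSpace ℂ b)
    (u v : EuclideanSpace ℂ a) : (ketBra x u).toEuclideanLin v = inner ℂ u v • x := by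
  ext i
  simp [ketBra, Matrix.vecMulVec_mulVec, EuclideanSpace.inner_eq_star_dotProduct,
    dotProduct_comm, mul_comm]

theorem mul_ketBra [Fintype a] [DecidableEq a] (K : Matrix b a ℂ) (x : EuclideanSpace ℂ a)
    (u : EuclideanSpace ℂ c) : K * ketBra x u = ketBra (K.toEuclideanLin x) u :=
  Matrix.mul_vecMulVec _ _ _

theorem trace_mul_pureState [Fintype a] [DecidableEq a] (K : Matrix a a ℂ)
    (x : EuclideanSpace ℂ a) : (K * pureState x).trace = inner ℂ x (K.toEuclideanLin x) := by
  rw [← ketBra_self, mul_ketBra, trace_ketBra]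

theorem eq_of_forall_trace_mul_pureState [Fintype a] {A B : Matrix a a ℂ}
    (h : ∀ v, (A * pureState v).trace = (B * pureState v).trace) : A = B := by
  classical
  refine Matrix.toEuclideanLin.injective ((ext_inner_map _ _).1 fun v => ?_)
  rw [← inner_conj_symm, ← trace_mul_pureState, h, trace_mul_pureState, inner_conj_symm]

theorem pureState_ofReal_smul (r : ℝ) (x : EuclideanSpace ℂ a) :
    pureState ((r : ℂ) • x) = (r ^ 2 : ℂ) • pureState x := by
  ext
  simp only [pureState, Complex.coe_smul, WithLp.ofLp_smul, star_smul, star_trivial,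
    Matrix.vecMulVec_apply, Matrix.smul_apply, Pi.smul_apply, Pi.star_apply, Complex.real_smul,
    smul_eq_mul]
  ring

theorem krausMap_pureState [Fintype a] [DecidableEq a] (K : Matrix b a ℂ)
    (x : EuclideanSpace ℂ a) : krausMap K (pureState x) = pureState (K.toEuclideanLin x) := by
  rw [krausMap_apply, ← ketBra_self, mul_ketBra, ← conjTranspose_ketBra,
    ← Matrix.conjTranspose_mul, mul_ketBra, conjTranspose_ketBra, ketBra_self]

theorem krausMap_ketBra_apply [Fintype a] (x : EuclideanSpace ℂ b) (u : EuclideanSpace ℂ a)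
    (X : Matrix a a ℂ) :
    krausMap (ketBra x u) X = (X * pureState u).trace • pureState x := by
  classical
  rw [krausMap_apply, Matrix.mul_assoc, conjTranspose_ketBra, mul_ketBra, ketBra_mul_ketBra,
    trace_mul_pureState, ketBra_self]

theorem trace_pureState_mul_pureState [Fintype a] (x y : EuclideanSpace ℂ a) :
    (pureState x * pureState y).trace = ‖inner ℂ y x‖ ^ 2 := by
  rw [← ketBra_self, ← ketBra_self, ketBra_mul_ketBra, Matrix.trace_smul, trace_ketBra,
    smul_eq_mul, ← inner_conj_symm x y, Complex.conj_mul']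

theorem inner_productVector [Fintype a] [Fintype b] (x u : EuclideanSpace ℂ a)
    (y v : EuclideanSpace ℂ b) :
    inner ℂ (productVector x y) (productVector u v) = inner ℂ x u * inner ℂ y v := by
  simp only [PiLp.inner_apply, productVector, Fintype.sum_prod_type, Finset.sum_mul_sum]
  simp [mul_mul_mul_comm]

theorem ketBra_kronecker_ketBra (x : EuclideanSpace ℂ b) (u : EuclideanSpace ℂ a)
    (y : EuclideanSpace ℂ e) (v : EuclideanSpace ℂ c) :
    ketBra x u ⊗ₖ ketBra y v = ketBra (productVector x y) (productVector u v) := by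
  ext
  simp [ketBra, productVector, Matrix.vecMulVec_apply, mul_mul_mul_comm]

theorem pureState_productVector (x : EuclideanSpace ℂ a) (y : EuclideanSpace ℂ b) :
    pureState (productVector x y) = pureState x ⊗ₖ pureState y := by
  simp only [← ketBra_self, ketBra_kronecker_ketBra]

theorem toEuclideanLin_kronecker_productVector [Fintype a] [DecidableEq a] [Fintype c]
    [DecidableEq c] (A : Matrix b a ℂ) (B : Matrix e c ℂ) (x : EuclideanSpace ℂ a)
    (y : EuclideanSpace ℂ c) :
    (A ⊗ₖ B).toEuclideanLin (productVector x y) =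
      productVector (A.toEuclideanLin x) (B.toEuclideanLin y) := by
  ext p
  simp [productVector, Matrix.mulVec, dotProduct, Fintype.sum_prod_type, Finset.sum_mul_sum,
    mul_mul_mul_comm]

end KetBra

section Swap

open scoped Kronecker Matrix.Norms.Frobenius

variable {d : ℕ}

theorem continuous_productVector {X a b : Type*} [TopologicalSpace X]
    {ψ : X → EuclideanSpace ℂ a} {φ : X → EuclideanSpace ℂ b} (hψ : Continuous ψ)
    (hφ : Continuous φ) : Continuous fun x => productVector (ψ x) (φ x) :=
  (PiLp.continuous_toLp 2 _).comp (by fun_prop)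

theorem trace_krausMap_kronecker_mul_pureState (A B : Matrix (Fin d) (Fin d) ℂ)
    (ψ φ : EuclideanSpace ℂ (Fin d)) :
    (krausMap (A ⊗ₖ B) (pureState (productVector ψ φ)) * pureState (productVector φ ψ)).trace =
      (‖inner ℂ φ (A.toEuclideanLin ψ)‖ ^ 2 * ‖inner ℂ ψ (B.toEuclideanLin φ)‖ ^ 2 : ℝ) := by
  rw [krausMap_pureState, toEuclideanLin_kronecker_productVector, trace_pureState_mul_pureState,
    inner_productVector, norm_mul]
  push_cast
  ring

theorem averageFidelity_swapOperator_sum_krausMap_kronecker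
    (P : Measure (StateVector d × StateVector d)) [IsFiniteMeasure P]
    {ι : Type*} [Fintype ι] (A B : ι → Matrix (Fin d) (Fin d) ℂ) :
    averageFidelity P (fun ω => productVector ω.1.1 ω.2.1) (swapOperator d)
        (∑ t, krausMap (A t ⊗ₖ B t)) =
      ∑ t, ∫ ω, ‖inner ℂ ω.2.1 ((A t).toEuclideanLin ω.1.1)‖ ^ 2 *
        ‖inner ℂ ω.1.1 ((B t).toEuclideanLin ω.2.1)‖ ^ 2 ∂P := by
  simp only [averageFidelity, swapOperator_productVector, LinearMap.sum_apply, Matrix.sum_mul,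
    Matrix.trace_sum, trace_krausMap_kronecker_mul_pureState, ← Complex.ofReal_sum,
    Complex.ofReal_re]
  exact integral_finsetSum _ fun t _ =>
    integrable_sq_norm_inner_apply_mul_sq_norm_inner_apply P (A t).toEuclideanLin
      (B t).toEuclideanLin

/-- Each product Kraus operator contributes at most `(2 / (d (d + 1)))² ‖A‖² ‖B‖²`, and trace
preservation fixes the total Frobenius weight at `d²`. -/
theorem IsLOCC.averageFidelity_swapOperator_le {μ ν : Measure (StateVector d)}
    [IsProbabilityMeasure μ] [IsProbabilityMeasure ν] (hμ : IsUnitarilyInvariant μ)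
    (hν : IsUnitarilyInvariant ν) [NeZero d]
    {Λ : Matrix (Fin d × Fin d) (Fin d × Fin d) ℂ →ₗ[ℂ] Matrix (Fin d × Fin d) (Fin d × Fin d) ℂ}
    (hΛ : IsLOCC Λ) :
    averageFidelity (μ.prod ν) (fun ω => productVector ω.1.1 ω.2.1) (swapOperator d) Λ ≤
      (2 / (d + 1)) ^ 2 := by
  obtain ⟨ι, _, A, B, rfl⟩ := hΛ.exists_eq_sum_krausMap_kronecker
  have integral_le (t) := hμ.integral_prod_sq_norm_inner_apply_mul_le hν
    (EuclideanSpace.basisFun (Fin d) ℂ) (A t).toEuclideanLin (B t).toEuclideanLin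
  simp only [← Matrix.toEuclideanLin_conjTranspose_eq_adjoint, finrank_euclideanSpace_fin,
    sum_sq_norm_toEuclideanLin_basisFun, Matrix.frobenius_norm_conjTranspose] at integral_le
  rw [averageFidelity_swapOperator_sum_krausMap_kronecker]
  refine (Finset.sum_le_sum fun t _ => integral_le t).trans_eq ?_
  rw [← Finset.mul_sum, hΛ.sum_sq_norm_mul_sq_norm]
  field_simp [NeZero.ne d]

theorem IsLimitOfLOCC.averageFidelity_swapOperator_le {μ ν : Measure (StateVector d)}
    [IsProbabilityMeasure μ] [IsProbabilityMeasure ν] (hμ : IsUnitarilyInvariant μ)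
    (hν : IsUnitarilyInvariant ν) [NeZero d]
    {Λ : Matrix (Fin d × Fin d) (Fin d × Fin d) ℂ →ₗ[ℂ] Matrix (Fin d × Fin d) (Fin d × Fin d) ℂ}
    (hΛ : IsLimitOfLOCC Λ) :
    averageFidelity (μ.prod ν) (fun ω => productVector ω.1.1 ω.2.1) (swapOperator d) Λ ≤
      (2 / (d + 1)) ^ 2 := by
  obtain ⟨Λs, isLOCC_Λs, tendsto_Λs⟩ := hΛ
  have continuous_ens : Continuous fun ω : StateVector d × StateVector d =>
      productVector ω.1.1 ω.2.1 := continuous_productVector (by fun_prop) (by fun_prop)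
  exact le_of_tendsto' (tendsto_averageFidelity _ continuous_ens _ tendsto_Λs)
    fun t => (isLOCC_Λs t).averageFidelity_swapOperator_le hμ hν

end Swap

/-! ### The measure-and-exchange protocol -/

section Protocol

open scoped Kronecker

variable {d n : ℕ}

theorem isInstrument_krausMap {m k : ℕ} {r : Fin k → ℕ} {K : ∀ i, Matrix (Fin (r i)) (Fin m) ℂ}
    (hK : ∑ i, (K i).conjTranspose * K i = 1) : IsInstrument fun i => krausMap (K i) where
  completelyPositive i := isCompletelyPositive_krausMap (K i)
  tracePreserving X := by
    simp only [krausMap_apply, Matrix.trace_mul_comm _ (K _).conjTranspose, ← Matrix.mul_assoc,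
      ← Matrix.trace_sum, ← Matrix.sum_mul, hK, Matrix.one_mul]

theorem isInstrument_krausMap_ketBra {m k : ℕ} {r : Fin k → ℕ}
    {x : ∀ i, EuclideanSpace ℂ (Fin (r i))} {u : Fin k → EuclideanSpace ℂ (Fin m)}
    (hx : ∀ i, ‖x i‖ = 1) (hu : ∑ i, pureState (u i) = 1) :
    IsInstrument fun i => krausMap (ketBra (x i) (u i)) := by
  refine isInstrument_krausMap ?_
  simpa only [conjTranspose_ketBra, ketBra_mul_ketBra, inner_self_eq_norm_sq_to_K, hx,
    RCLike.ofReal_one, one_pow, one_smul, ketBra_self] using hu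

/-- The channel in which both parties perform the measurement with rank-one effects
`|u s⟩⟨u s|`, exchange the outcomes, and prepare `x s` upon receiving the outcome `s`. -/
def measureExchangePrepare (x u : Fin n → EuclideanSpace ℂ (Fin d)) :
    Matrix (Fin d × Fin d) (Fin d × Fin d) ℂ →ₗ[ℂ] Matrix (Fin d × Fin d) (Fin d × Fin d) ℂ :=
  ∑ s, ∑ t, krausMap (ketBra (x t) (u s) ⊗ₖ ketBra (x s) (u t))

theorem measureExchangePrepare_apply (x u : Fin n → EuclideanSpace ℂ (Fin d))
    (X : Matrix (Fin d × Fin d) (Fin d × Fin d) ℂ) :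
    measureExchangePrepare x u X = ∑ s, ∑ t, (X * pureState (productVector (u s) (u t))).trace •
      pureState (productVector (x t) (x s)) := by
  simp only [measureExchangePrepare, LinearMap.sum_apply, ketBra_kronecker_ketBra,
    krausMap_ketBra_apply]

/-- The first party discards their system after measuring, keeping the trivial system `ℂ¹` until
the other party's outcome arrives. -/
theorem isLOCC_measureExchangePrepare {x u : Fin n → EuclideanSpace ℂ (Fin d)}
    (hx : ∀ s, ‖x s‖ = 1) (hu : ∑ s, pureState (u s) = 1) :
    IsLOCC (measureExchangePrepare x u) := by
  let e : EuclideanSpace ℂ (Fin 1) := EuclideanSpace.single 0 1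
  have norm_e : ‖e‖ = 1 := by simp [e]
  have pureState_e : pureState e = 1 := by
    ext i j
    fin_cases i
    fin_cases j
    simp [e, pureState, Matrix.vecMulVec_apply]
  have prepare_fst (t) : IsLOCC (krausMap (ketBra (x t) e ⊗ₖ (1 : Matrix (Fin d) (Fin d) ℂ))) := by
    have h := IsLOCC.first (n := d) (k := 1) (r := fun _ => d) _
      (isInstrument_krausMap_ketBra (fun _ => hx t) (u := fun _ => e)
        ((Fin.sum_univ_one _).trans pureState_e))
      (fun _ => LinearMap.id) fun _ => IsLOCC.idle
    rwa [Fin.sum_univ_one, LinearMap.id_comp, onFst_krausMap] at h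
  have measure_snd (s) : IsLOCC (∑ t, krausMap (ketBra (x t) e ⊗ₖ ketBra (x s) (u t))) := by
    have h := IsLOCC.second _ (isInstrument_krausMap_ketBra (fun _ => hx s) hu) _ prepare_fst
    simpa only [onSnd_krausMap, krausMap_comp_krausMap, ← Matrix.mul_kronecker_mul,
      Matrix.one_mul, Matrix.mul_one] using h
  have h := IsLOCC.first _ (isInstrument_krausMap_ketBra (fun _ => norm_e) hu) _ measure_snd
  simpa only [measureExchangePrepare, onFst_krausMap, sum_krausMap_comp_krausMap,
    ← Matrix.mul_kronecker_mul, Matrix.mul_one, ketBra_mul_ketBra, inner_self_eq_norm_sq_to_K,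
    norm_e, RCLike.ofReal_one, one_pow, one_smul] using h

theorem averageFidelity_measureExchangePrepare {μ ν : Measure (StateVector d)}
    [IsProbabilityMeasure μ] [IsProbabilityMeasure ν] (hμ : IsUnitarilyInvariant μ)
    (hν : IsUnitarilyInvariant ν) [NeZero d] {x u : Fin n → EuclideanSpace ℂ (Fin d)}
    (hx : ∀ s, ‖x s‖ = 1) (hu : ∑ s, pureState (u s) = 1) (hux : ∀ s, u s = (‖u s‖ : ℂ) • x s) :
    averageFidelity (μ.prod ν) (fun ω => productVector ω.1.1 ω.2.1) (swapOperator d)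
      (measureExchangePrepare x u) = (2 / (d + 1)) ^ 2 := by
  have sum_sq_norm : ∑ s, ‖u s‖ ^ 2 = d := by
    have h := congrArg Matrix.trace hu
    simp only [Matrix.trace_sum, trace_pureState, Matrix.trace_one, Fintype.card_fin] at h
    exact_mod_cast h
  have sq_norm_inner (s) (v : EuclideanSpace ℂ (Fin d)) :
      ‖inner ℂ (u s) v‖ ^ 2 = ‖u s‖ ^ 2 * ‖inner ℂ v (x s)‖ ^ 2 := by
    rw [hux s, inner_smul_left, ← hux s, norm_mul, mul_pow, norm_inner_symm]
    simp
  have integral_eq (s t) : ∫ ω, ‖inner ℂ ω.2.1 ((ketBra (x t) (u s)).toEuclideanLin ω.1.1)‖ ^ 2 *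
      ‖inner ℂ ω.1.1 ((ketBra (x s) (u t)).toEuclideanLin ω.2.1)‖ ^ 2 ∂μ.prod ν =
        ‖u s‖ ^ 2 * ‖u t‖ ^ 2 * (2 / (d * (d + 1))) ^ 2 := by
    calc _ = ∫ ω, ‖u s‖ ^ 2 * ‖u t‖ ^ 2 *
          (‖inner ℂ ω.1.1 (x s)‖ ^ 4 * ‖inner ℂ ω.2.1 (x t)‖ ^ 4) ∂μ.prod ν := by
          simp only [toEuclideanLin_ketBra, inner_smul_right, norm_mul, mul_pow, sq_norm_inner]
          congr! 2
          ring
      _ = _ := by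
          rw [integral_const_mul,
            integral_prod_mul (fun ψ : StateVector d => ‖inner ℂ ψ.1 (x s)‖ ^ 4)
              fun φ : StateVector d => ‖inner ℂ φ.1 (x t)‖ ^ 4,
            hμ.integral_norm_inner_pow_four,
            hν.integral_norm_inner_pow_four, hx, hx, finrank_euclideanSpace_fin]
          ring
  have fidelity_eq := averageFidelity_swapOperator_sum_krausMap_kronecker (μ.prod ν)
    (fun p : Fin n × Fin n => ketBra (x p.2) (u p.1)) (fun p => ketBra (x p.1) (u p.2))
  simp only [integral_eq, Fintype.sum_prod_type, ← Finset.sum_mul, ← Finset.sum_mul_sum,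
    sum_sq_norm] at fidelity_eq
  rw [measureExchangePrepare, fidelity_eq]
  field_simp [NeZero.ne d]

end Protocol

section TwoDesign

open scoped Kronecker

variable {d n : ℕ}

/-- A weighted complex projective 2-design for `μ`: finitely many state vectors that reproduce the
`μ`-averages of all polynomials of degree two in `|ψ⟩⟨ψ|`, encoded as products of two linear
functionals. -/
structure IsTwoDesign (μ : Measure (StateVector d)) (w : Fin n → ℝ) (x : Fin n → StateVector d) :
    Prop where
  nonneg : ∀ s, 0 ≤ w s
  integral_mul : ∀ α γ : Matrix (Fin d) (Fin d) ℂ →ₗ[ℂ] ℂ,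
    ∫ ψ, α (pureState ψ.1) * γ (pureState ψ.1) ∂μ =
      ∑ s, w s * (α (pureState (x s).1) * γ (pureState (x s).1))

theorem continuous_pureState_coe :
    Continuous fun ψ : StateVector d => pureState (ψ : EuclideanSpace ℂ (Fin d)) :=
  continuous_pureState.comp continuous_subtype_val

theorem exists_isTwoDesign (μ : Measure (StateVector d)) [IsProbabilityMeasure μ] :
    ∃ (n : ℕ) (w : Fin n → ℝ) (x : Fin n → StateVector d), IsTwoDesign μ w x := by
  obtain ⟨n, w, x, hw, hx⟩ :=
    exists_bilinear_quadrature μ continuous_pureState_coe (continuous_pureState_coe (d := d))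
  exact ⟨n, w, x, hw, fun α γ => hx ((LinearMap.mul ℂ ℂ).compl₁₂ α γ)⟩

namespace IsTwoDesign

variable {μ : Measure (StateVector d)} {w : Fin n → ℝ} {x : Fin n → StateVector d}

theorem sum_mul_sq_norm_inner (h : IsTwoDesign μ w x) (v : EuclideanSpace ℂ (Fin d)) :
    ∑ s, w s * ‖inner ℂ (x s).1 v‖ ^ 2 = ∫ ψ, ‖inner ℂ ψ.1 v‖ ^ 2 ∂μ := by
  have integral_eq := h.integral_mul
    (Matrix.traceLinearMap (Fin d) ℂ ℂ ∘ₗ LinearMap.mulRight ℂ (pureState v))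
    (Matrix.traceLinearMap (Fin d) ℂ ℂ)
  simp only [LinearMap.comp_apply, LinearMap.mulRight_apply, Matrix.traceLinearMap_apply,
    trace_pureState_mul_pureState, norm_inner_symm v, trace_pureState, norm_eq_of_mem_sphere,
    one_pow, Complex.ofReal_one, mul_one] at integral_eq
  exact_mod_cast integral_eq.symm

theorem ofReal_sqrt_mul_sq (h : IsTwoDesign μ w x) (s : Fin n) :
    ((√(d * w s) : ℝ) : ℂ) ^ 2 = d * w s := by
  exact_mod_cast Real.sq_sqrt (mul_nonneg d.cast_nonneg (h.nonneg s))

theorem sum_pureState_eq_one (h : IsTwoDesign μ w x) (hμ : IsUnitarilyInvariant μ)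
    [IsProbabilityMeasure μ] [NeZero d] :
    ∑ s, pureState (((√(d * w s) : ℝ) : ℂ) • (x s).1) = 1 := by
  refine eq_of_forall_trace_mul_pureState fun v => ?_
  have sum_eq := h.sum_mul_sq_norm_inner v
  rw [hμ.integral_sq_norm_inner, finrank_euclideanSpace_fin,
    eq_div_iff (NeZero.ne (d : ℝ))] at sum_eq
  simp only [pureState_ofReal_smul, h.ofReal_sqrt_mul_sq, Matrix.sum_mul,
    Matrix.trace_sum, Matrix.smul_mul, Matrix.trace_smul, trace_pureState_mul_pureState,
    Matrix.one_mul, trace_pureState, smul_eq_mul, mul_assoc, ← Finset.mul_sum, norm_inner_symm v]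
  rw [mul_comm]
  exact_mod_cast sum_eq

/-- For fixed `φ` the integrand is a product of two linear functionals of `|ψ⟩⟨ψ|`, and vice versa,
so by Fubini the design can be applied to one variable at a time. -/
theorem integral_prod_mul [IsProbabilityMeasure μ] (h : IsTwoDesign μ w x)
    (β γ : Matrix (Fin d) (Fin d) ℂ →ₗ[ℂ] Matrix (Fin d) (Fin d) ℂ →ₗ[ℂ] ℂ) :
    ∫ ω, β (pureState ω.1.1) (pureState ω.2.1) * γ (pureState ω.1.1) (pureState ω.2.1) ∂μ.prod μ =
      ∑ s, ∑ t, w s * w t * (β (pureState (x s).1) (pureState (x t).1) *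
        γ (pureState (x s).1) (pureState (x t).1)) := by
  let f (ψ φ : StateVector d) : ℂ := β (pureState ψ.1) (pureState φ.1) *
    γ (pureState ψ.1) (pureState φ.1)
  have f_continuous : Continuous f.uncurry :=
    have hfst := continuous_pureState_coe.comp (continuous_fst (X := StateVector d))
    have hsnd := continuous_pureState_coe.comp (continuous_snd (Y := StateVector d))
    (continuous_bilinear_apply β hfst hsnd).mul (continuous_bilinear_apply γ hfst hsnd)
  have integral_snd (ψ) : ∫ φ, f ψ φ ∂μ = ∑ t, w t * f ψ (x t) :=
    h.integral_mul (β (pureState ψ.1)) (γ (pureState ψ.1))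
  have integral_fst (φ) : ∫ ψ, f ψ φ ∂μ = ∑ s, w s * f (x s) φ :=
    h.integral_mul (β.flip (pureState φ.1)) (γ.flip (pureState φ.1))
  exact integral_prod_eq_sum_sum f_continuous integral_fst integral_snd

theorem integral_trace_mul_pureState_productVector [IsProbabilityMeasure μ]
    (h : IsTwoDesign μ w x) (X : Matrix (Fin d × Fin d) (Fin d × Fin d) ℂ) (p q : Fin d × Fin d) :
    ∫ ω, (X * pureState (productVector ω.1.1 ω.2.1)).trace *
        pureState (productVector ω.2.1 ω.1.1) p q ∂μ.prod μ =
      ∑ s, ∑ t, w s * w t * ((X * pureState (productVector (x s).1 (x t).1)).trace *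
        pureState (productVector (x t).1 (x s).1) p q) := by
  let kron : Matrix (Fin d) (Fin d) ℂ →ₗ[ℂ] Matrix (Fin d) (Fin d) ℂ →ₗ[ℂ]
    Matrix (Fin d × Fin d) (Fin d × Fin d) ℂ := Matrix.kroneckerBilinear
  simp only [pureState_productVector]
  exact h.integral_prod_mul
    (kron.compr₂ (Matrix.traceLinearMap (Fin d × Fin d) ℂ ℂ ∘ₗ LinearMap.mulLeft ℂ X))
    (kron.flip.compr₂ (Matrix.entryLinearMap ℂ ℂ p q))

theorem measureExchangePrepare_apply_eq_integral [IsProbabilityMeasure μ]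
    (h : IsTwoDesign μ w x) (X : Matrix (Fin d × Fin d) (Fin d × Fin d) ℂ) (p q : Fin d × Fin d) :
    measureExchangePrepare (fun s => (x s).1) (fun s => ((√(d * w s) : ℝ) : ℂ) • (x s).1) X p q =
      d ^ 2 * ∫ ω, (X * pureState (productVector ω.1.1 ω.2.1)).trace *
        pureState (productVector ω.2.1 ω.1.1) p q ∂μ.prod μ := by
  rw [h.integral_trace_mul_pureState_productVector, measureExchangePrepare_apply]
  simp only [pureState_productVector, pureState_ofReal_smul, h.ofReal_sqrt_mul_sq,
    Matrix.smul_kronecker, Matrix.kronecker_smul,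
    Matrix.mul_smul, Matrix.trace_smul, Matrix.sum_apply, Matrix.smul_apply, smul_eq_mul,
    Finset.mul_sum]
  congr! 2
  ring

end IsTwoDesign

end TwoDesign

theorem exists_isLOCC_averageFidelity_eq {d : ℕ} [NeZero d]
    {μ : Measure (StateVector d)} [IsProbabilityMeasure μ] (hμ : IsUnitarilyInvariant μ) :
    ∃ Λ : Matrix (Fin d × Fin d) (Fin d × Fin d) ℂ →ₗ[ℂ] Matrix (Fin d × Fin d) (Fin d × Fin d) ℂ,
      IsLOCC Λ ∧
      (∀ X p q, Λ X p q = d ^ 2 * ∫ ω, (X * pureState (productVector ω.1.1 ω.2.1)).trace *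
        pureState (productVector ω.2.1 ω.1.1) p q ∂μ.prod μ) ∧
      averageFidelity (μ.prod μ) (fun ω => productVector ω.1.1 ω.2.1) (swapOperator d) Λ =
        (2 / (d + 1)) ^ 2 := by
  obtain ⟨n, w, x, design⟩ := exists_isTwoDesign μ
  have norm_x (s) : ‖(x s).1‖ = 1 := by simp
  have povm := design.sum_pureState_eq_one hμ
  exact ⟨_, isLOCC_measureExchangePrepare norm_x povm,
    design.measureExchangePrepare_apply_eq_integral,
    averageFidelity_measureExchangePrepare hμ hμ norm_x povm fun s => by
      simp [norm_smul, abs_of_nonneg]⟩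

theorem mainTheorem6 (d : ℕ) (hd : 1 ≤ d) :
    let μ : Measure (StateVector d × StateVector d) := (haarState d).prod (haarState d)
    let ens : StateVector d × StateVector d → EuclideanSpace ℂ (Fin d × Fin d) :=
      fun ω => productVector ω.1.1 ω.2.1
    -- no LOCC channel, nor any limit of LOCC channels, exceeds the bound
    (∀ Λ : Matrix (Fin d × Fin d) (Fin d × Fin d) ℂ →ₗ[ℂ]
        Matrix (Fin d × Fin d) (Fin d × Fin d) ℂ,
      (IsLOCC Λ ∨ IsLimitOfLOCC Λ) →
        averageFidelity μ ens (swapOperator d) Λ ≤ (2 / ((d : ℝ) + 1)) ^ 2) ∧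
    -- both parties measuring with the uniform POVM and preparing the outcome on the
    -- other side is an LOCC channel that attains it
    (∃ Λ : Matrix (Fin d × Fin d) (Fin d × Fin d) ℂ →ₗ[ℂ]
        Matrix (Fin d × Fin d) (Fin d × Fin d) ℂ,
      IsLOCC Λ ∧
      (∀ X p q, Λ X p q = (d : ℂ) ^ 2 * ∫ ω, Matrix.trace (X * pureState (ens ω)) *
        pureState (productVector ω.2.1 ω.1.1) p q ∂μ) ∧
      averageFidelity μ ens (swapOperator d) Λ = (2 / ((d : ℝ) + 1)) ^ 2) ∧
    simulationFidelity μ ens (swapOperator d) = (2 / ((d : ℝ) + 1)) ^ 2 := by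
  intro μ ens
  have : NeZero d := ⟨by omega⟩
  have haar_invariant := isUnitarilyInvariant_haarState d
  have fidelity_le : ∀ Λ, IsLOCC Λ ∨ IsLimitOfLOCC Λ →
      averageFidelity μ ens (swapOperator d) Λ ≤ (2 / ((d : ℝ) + 1)) ^ 2 := fun Λ hΛ =>
    hΛ.elim (·.averageFidelity_swapOperator_le haar_invariant haar_invariant)
      (·.averageFidelity_swapOperator_le haar_invariant haar_invariant)
  obtain ⟨Λ, isLOCC, apply_eq, fidelity_eq⟩ := exists_isLOCC_averageFidelity_eq haar_invariant
  refine ⟨fidelity_le, ⟨Λ, isLOCC, apply_eq, fidelity_eq⟩,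
    IsGreatest.csSup_eq ⟨⟨Λ, isLOCC, fidelity_eq⟩, ?_⟩⟩
  rintro _ ⟨Λ', hΛ', rfl⟩
  exact fidelity_le Λ' (.inl hΛ')
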